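/- A binary tree is either the empty tree $\emptyset$ or a root node carrying an ordered pair $(L,R)$ of binary trees, its left and right subtrees; write $T=\bullet(L,R)$. A right rotation of a tree replaces one subtree of the form $y(x(A,B),C)$ by $x(A,y(B,C))$, where $A,B,C$ are binary trees, possibly empty. In the Tamari order, $S\le T$ if $T$ can be obtained from $S$ by a finite (possibly empty) sequence of right rotations. The left branch (resp. right branch) of a nonempty tree consists of the root, its left (resp. right) child, the left (resp. right) child of that node, and so on; the branches of $\emptyset$ have no nodes. For polynomials $f,g$ in $x$ with coefficients depending on $y$, put $$B(f,g)=x\,y\,f\cdot\frac{x\,g-g|_{x=1}}{x-1},$$ which is again a polynomial. The Tamari polynomial $\mathcal B_T(x)\in\mathbb Z[x]$ of a binary tree is defined recursively by $\mathcal B_\emptyset=1$ and $\mathcal B_T=B_{y=1}(\mathcal B_L,\mathcal B_R)$ for $T=\bullet(L,R)$. The polynomial $\tilde{\mathcal B}_T(x)\in\mathbb Z[x]$ is defined by exchanging the roles of the two subtrees: $\tilde{\mathcal B}_\emptyset=1$ and $\tilde{\mathcal B}_T=B_{y=1}(\tilde{\mathcal B}_R,\tilde{\mathcal B}_L)$ for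 $T=\bullet(L,R)$. Theorem. Let $T$ be a binary tree. 1. The set of trees $T'\le T$ is finite, and for every integer $k\ge 0$ the coefficient of $x^k$ in $\mathcal B_T(x)$ is the number of trees $T'\le T$ having exactly $k$ nodes on their left branch. In particular $\mathcal B_T(1)$ is the number of trees $T'\le T$. 2. The set of trees $T'\ge T$ is finite, and for every integer $k\ge 0$ the coefficient of $x^k$ in $\tilde{\mathcal B}_T(x)$ is the number of trees $T'\ge T$ having exactly $k$ nodes on their right branch. In particular $\tilde{\mathcal B}_T(1)$ is the number of trees $T'\ge T$. -/

import Mathlib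

namespace Tamari

open Polynomial

/-- A (planar) binary tree: either empty (`BinaryTree.nil`) or a root carrying a left and a right
binary subtree. -/
abbrev BinTree : Type := BinaryTree Unit

/-- The tree with root `•`, left subtree `L` and right subtree `R`. -/
abbrev graft (L R : BinTree) : BinTree := BinaryTree.node () L R

/-- `RightRotation S T`: the tree `T` is obtained from `S` by one right rotation at some node, that
is, by replacing one subtree `y(x(A, B), C)` of `S` by `x(A, y(B, C))`. -/
inductive RightRotation : BinTree → BinTree → Prop
  | root (A B C : BinTree) : RightRotation (graft (graft A B) C) (graft A (graft B C))
  | left {L L' : BinTree} (R : BinTree) (h : RightRotation L L') :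
      RightRotation (graft L R) (graft L' R)
  | right (L : BinTree) {R R' : BinTree} (h : RightRotation R R') :
      RightRotation (graft L R) (graft L R')

/-- The Tamari order: `TamariLE S T` if `T` can be reached from `S` by a (possibly empty) sequence
of right rotations. -/
def TamariLE (S T : BinTree) : Prop := Relation.ReflTransGen RightRotation S T

/-- The number of nodes on the left branch: the root, its left child, the left child of that, etc. -/
def leftBranch : BinTree → ℕ
  | .nil => 0
  | .node _ L _ => leftBranch L + 1

/-- The number of nodes on the right branch. -/
def rightBranch : BinTree → ℕ
  | .nil => 0
  | .node _ _ R => rightBranch R + 1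

/-- The bilinear operator `B(f, g) = x y f (x g - g(1)) / (x - 1)` on polynomials in `x`, with `y`
any element of the coefficient ring. The division by the monic polynomial `x - 1` is exact,
see `sub_one_mul_B`. -/
noncomputable def B {K : Type*} [CommRing K] (y : K) (f g : K[X]) : K[X] :=
  X * C y * f * ((X * g - C (g.eval 1)) /ₘ (X - C 1))

theorem sub_one_mul_B {K : Type*} [CommRing K] (y : K) (f g : K[X]) :
    (X - C 1) * B y f g = X * C y * f * (X * g - C (g.eval 1)) := by
  have h : (X - C 1) * ((X * g - C (g.eval 1)) /ₘ (X - C 1)) = X * g - C (g.eval 1) :=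
    mul_divByMonic_eq_iff_isRoot.2 (by simp [IsRoot.def])
  rw [B, mul_left_comm, h]

/-- The Tamari polynomial `B_T(x)` of a binary tree. -/
noncomputable def tamariPoly : BinTree → ℤ[X]
  | .nil => 1
  | .node _ L R => B 1 (tamariPoly L) (tamariPoly R)

/-- The polynomial obtained by exchanging the roles of the left and the right subtrees in the
definition of the Tamari polynomial. -/
noncomputable def tamariPolyRev : BinTree → ℤ[X]
  | .nil => 1
  | .node _ L R => B 1 (tamariPolyRev R) (tamariPolyRev L)

end Tamari

namespace Tamari

open Polynomial

/-! The trees below `graft L R` are exactly the insertions of some `L' ≤ L` into the left branch of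
some `R' ≤ R` (`tamariLE_graft_iff`). The pair `(L', R')` is unique because rotations preserve size
(`Inserts.unique`). If `L'` and `R'` have `l` and `r` nodes on their left branches, inserting at
depth `j = 0, ..., r` gives a left branch of `l + 1 + j` nodes. The total `x^(l+1) (1 + ... + x^r)`
is `B 1 (x^l) (x^r)`, so the generating polynomial satisfies the recursion of `tamariPoly`. Mirror
images reverse the order and yield the second half. -/

/-- `Inserts L R T`: the tree `T` is obtained from `R` by replacing one subtree `S` sitting along
its left branch (the whole tree and the empty tree at the end included) by `graft L S`. -/
inductive Inserts (L : BinTree) : BinTree → BinTree → Prop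
  | top (R : BinTree) : Inserts L R (graft L R)
  | step {A T : BinTree} (C : BinTree) (h : Inserts L A T) : Inserts L (graft A C) (graft T C)

theorem TamariLE.refl (T : BinTree) : TamariLE T T := Relation.ReflTransGen.refl

theorem TamariLE.trans {S T U : BinTree} (h : TamariLE S T) (h' : TamariLE T U) : TamariLE S U :=
  Relation.ReflTransGen.trans h h'

theorem RightRotation.tamariLE {S T : BinTree} (h : RightRotation S T) : TamariLE S T :=
  Relation.ReflTransGen.single h

theorem TamariLE.graft {L L' R R' : BinTree} (hL : TamariLE L L') (hR : TamariLE R R') :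
    TamariLE (graft L R) (graft L' R') :=
  TamariLE.trans
    (Relation.ReflTransGen.lift (Tamari.graft · R) (fun _ _ h => RightRotation.left R h) _ _ hL)
    (Relation.ReflTransGen.lift (Tamari.graft L' ·) (fun _ _ h => RightRotation.right L' h) _ _ hR)

theorem RightRotation.numNodes_eq {S T : BinTree} (h : RightRotation S T) :
    S.numNodes = T.numNodes := by
  induction h with
  | root A B C => simp only [BinaryTree.numNodes]; omega
  | left R h ih => simp only [BinaryTree.numNodes]; omega
  | right L h ih => simp only [BinaryTree.numNodes]; omega

theorem TamariLE.numNodes_eq {S T : BinTree} (h : TamariLE S T) : S.numNodes = T.numNodes := by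
  induction h with
  | refl => rfl
  | tail _ h ih => exact ih.trans h.numNodes_eq

theorem Inserts.numNodes_eq {L R T : BinTree} (h : Inserts L R T) :
    T.numNodes = L.numNodes + R.numNodes + 1 := by
  induction h with
  | top R => rfl
  | step C h ih => simp only [BinaryTree.numNodes]; omega

/-- One rotation per level lifts the inserted node up the left branch to the root. -/
theorem Inserts.tamariLE {L R T : BinTree} (h : Inserts L R T) : TamariLE T (graft L R) := by
  induction h with
  | top R => exact .refl _
  | step C h ih => exact (ih.graft (.refl C)).trans (RightRotation.root _ _ _).tamariLE

/-- An inserted tree determines the two trees it is made from, once the size of the first one is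
known. -/
theorem Inserts.unique {L L' R R' T : BinTree} (h : Inserts L R T) (h' : Inserts L' R' T)
    (hL : L.numNodes = L'.numNodes) : L = L' ∧ R = R' := by
  induction h generalizing R' with
  | top R =>
    cases h' with
    | top => exact ⟨rfl, rfl⟩
    | step C h => have := h.numNodes_eq; omega
  | step C h ih =>
    cases h' with
    | top => have := h.numNodes_eq; omega
    | step C h' =>
      obtain ⟨h₁, h₂⟩ := ih h'
      exact ⟨h₁, by rw [h₂]⟩

/-- Undoing a rotation lowers `L`, lowers `R`, or moves the inserted node one step down the left
branch. -/
theorem Inserts.exists_of_rightRotation {L R S T : BinTree} (h : Inserts L R T)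
    (hS : RightRotation S T) :
    ∃ L' R', TamariLE L' L ∧ TamariLE R' R ∧ Inserts L' R' S := by
  induction h generalizing S with
  | top R =>
    cases hS with
    | root A B C => exact ⟨_, _, .refl _, .refl _, .step C (.top B)⟩
    | left _ h => exact ⟨_, _, h.tamariLE, .refl _, .top _⟩
    | right _ h => exact ⟨_, _, .refl _, h.tamariLE, .top _⟩
  | step C h ih =>
    cases hS with
    | root A B C =>
      exact ⟨_, _, .refl _, (RightRotation.root _ B C).tamariLE, .step C (.step B h)⟩
    | left _ hS =>
      obtain ⟨L', R', hL, hR, h'⟩ := ih hS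
      exact ⟨L', _, hL, hR.graft (.refl C), .step C h'⟩
    | right _ hS => exact ⟨_, _, .refl _, (TamariLE.refl _).graft hS.tamariLE, .step _ h⟩

theorem tamariLE_graft_iff {L R T : BinTree} :
    TamariLE T (graft L R) ↔ ∃ L' R', TamariLE L' L ∧ TamariLE R' R ∧ Inserts L' R' T := by
  constructor
  · intro h
    induction h using Relation.ReflTransGen.head_induction_on with
    | refl => exact ⟨L, R, .refl _, .refl _, .top _⟩
    | head h _ ih =>
      obtain ⟨L', R', hL, hR, h'⟩ := ih
      obtain ⟨L₂, R₂, hL₂, hR₂, h₂⟩ := h'.exists_of_rightRotation h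
      exact ⟨L₂, R₂, hL₂.trans hL, hR₂.trans hR, h₂⟩
  · rintro ⟨L', R', hL, hR, h⟩
    exact h.tamariLE.trans (hL.graft hR)

theorem tamariLE_nil_iff {T : BinTree} : TamariLE T .nil ↔ T = .nil := by
  constructor
  · intro h
    cases h with
    | refl => rfl
    | tail _ h => cases h
  · rintro rfl
    exact .refl _

/-! ### Enumeration of lower sets and generating polynomials -/

open Classical in
/-- The finite set of all trees `T` with `Inserts L R T`. -/
noncomputable def insertions (L : BinTree) : BinTree → Finset BinTree
  | .nil => {graft L .nil}
  | .node _ A C => insert (graft L (graft A C)) ((insertions L A).image (graft · C))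

theorem mem_insertions {L R T : BinTree} : T ∈ insertions L R ↔ Inserts L R T := by
  induction R generalizing T with
  | nil =>
    rw [insertions, Finset.mem_singleton]
    constructor
    · rintro rfl
      exact .top _
    · intro h
      cases h
      rfl
  | node _ A C ihA _ =>
    simp only [insertions, Finset.mem_insert, Finset.mem_image, ihA]
    constructor
    · rintro (rfl | ⟨S, hS, rfl⟩)
      · exact .top _
      · exact .step C hS
    · intro h
      cases h with
      | top => exact .inl rfl
      | step C h => exact .inr ⟨_, h, rfl⟩

theorem sum_insertions (L R : BinTree) :
    ∑ T ∈ insertions L R, (X : ℤ[X]) ^ leftBranch T =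
      X ^ (leftBranch L + 1) * ∑ j ∈ Finset.range (leftBranch R + 1), X ^ j := by
  induction R with
  | nil => simp [insertions, leftBranch]
  | node _ A C ihA _ =>
    rw [insertions, Finset.sum_insert, Finset.sum_image]
    · simp only [leftBranch, pow_succ _ (leftBranch _), ← Finset.sum_mul]
      -- The split-off term `j = 0` is the insertion at the root; the others are one level deeper.
      rw [ihA, Finset.sum_range_succ' _ (leftBranch A + 1)]
      simp only [pow_succ, ← Finset.sum_mul]
      ring
    · intro S _ S' _ h
      simpa using h
    -- A coincidence would make `L` an insertion of itself, against the node count.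
    · simp only [Finset.mem_image, mem_insertions, not_exists, not_and]
      intro S hS h
      have h₁ := hS.numNodes_eq
      have h₂ : S = L := by simp_all
      rw [h₂] at h₁
      omega

open Classical in
/-- The finite set of all trees below a given one in the Tamari order. -/
noncomputable def lowerTrees : BinTree → Finset BinTree
  | .nil => {.nil}
  | .node _ L R => (lowerTrees L ×ˢ lowerTrees R).biUnion fun p => insertions p.1 p.2

theorem mem_lowerTrees {S T : BinTree} : S ∈ lowerTrees T ↔ TamariLE S T := by
  induction T generalizing S with
  | nil => simp [lowerTrees, tamariLE_nil_iff]
  | node _ L R ihL ihR =>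
    rw [tamariLE_graft_iff]
    simp [lowerTrees, mem_insertions, ihL, ihR]

theorem sum_lowerTrees_graft (L R : BinTree) :
    ∑ T ∈ lowerTrees (graft L R), (X : ℤ[X]) ^ leftBranch T =
      ∑ L' ∈ lowerTrees L, ∑ R' ∈ lowerTrees R,
        X ^ (leftBranch L' + 1) * ∑ j ∈ Finset.range (leftBranch R' + 1), X ^ j := by
  rw [lowerTrees, Finset.sum_biUnion, Finset.sum_product]
  · simp only [sum_insertions]
  · rintro ⟨L₁, R₁⟩ h₁ ⟨L₂, R₂⟩ h₂ hne
    refine Finset.disjoint_left.2 fun T hT₁ hT₂ => hne ?_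
    simp only [Finset.coe_product, Set.mem_prod, Finset.mem_coe, mem_lowerTrees] at h₁ h₂
    obtain ⟨rfl, rfl⟩ := (mem_insertions.1 hT₁).unique (mem_insertions.1 hT₂)
      (h₁.1.numNodes_eq.trans h₂.1.numNodes_eq.symm)
    rfl

theorem tamariPoly_eq_sum (T : BinTree) :
    tamariPoly T = ∑ S ∈ lowerTrees T, X ^ leftBranch S := by
  induction T with
  | nil => simp [tamariPoly, lowerTrees, leftBranch]
  | node _ L R ihL ihR =>
    -- Multiplying by `X - 1` replaces the division in `B` by telescoping geometric sums.
    refine mul_left_cancel₀ (X_sub_C_ne_zero (1 : ℤ)) ?_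
    rw [tamariPoly, sub_one_mul_B, sum_lowerTrees_graft, ihL, ihR]
    have geom (n : ℕ) : ((X : ℤ[X]) - C 1) * ∑ j ∈ Finset.range n, X ^ j = X ^ n - 1 := by
      rw [C_1, mul_geom_sum]
    have hR : X * ∑ S ∈ lowerTrees R, (X : ℤ[X]) ^ leftBranch S -
        C (eval 1 (∑ S ∈ lowerTrees R, (X : ℤ[X]) ^ leftBranch S)) =
        ∑ S ∈ lowerTrees R, ((X : ℤ[X]) - C 1) *
          ∑ j ∈ Finset.range (leftBranch S + 1), X ^ j := by
      simp only [geom, Finset.sum_sub_distrib, Finset.mul_sum, pow_succ', eval_finsetSum]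
      simp
    rw [hR]
    simp only [← Finset.mul_sum, ← Finset.sum_mul, pow_succ, C_1]
    ring

theorem finite_setOf_tamariLE (T : BinTree) : {S | TamariLE S T}.Finite :=
  (lowerTrees T).finite_toSet.subset fun _ h => mem_lowerTrees.2 h

theorem tamariPoly_coeff (T : BinTree) (k : ℕ) :
    (tamariPoly T).coeff k = ({S | TamariLE S T ∧ leftBranch S = k}.ncard : ℤ) := by
  classical
  have h : {S | TamariLE S T ∧ leftBranch S = k} =
      ((lowerTrees T).filter fun S => k = leftBranch S : Finset BinTree) := by
    ext S
    simp [mem_lowerTrees, eq_comm]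
  rw [h, Set.ncard_coe_finset, tamariPoly_eq_sum]
  simp [coeff_X_pow]

theorem tamariPoly_eval_one (T : BinTree) :
    (tamariPoly T).eval 1 = ({S | TamariLE S T}.ncard : ℤ) := by
  have h : {S | TamariLE S T} = (lowerTrees T : Set BinTree) := by
    ext S
    simp [mem_lowerTrees]
  rw [h, Set.ncard_coe_finset, tamariPoly_eq_sum]
  simp [eval_finsetSum]

/-! ### Order reversal by mirror images -/

/-- The mirror image of a binary tree. -/
def mirror : BinTree → BinTree
  | .nil => .nil
  | .node _ L R => graft (mirror R) (mirror L)

theorem mirror_involutive : Function.Involutive mirror := by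
  intro T
  induction T with
  | nil => rfl
  | node _ L R ihL ihR => simp [mirror, ihL, ihR]

theorem RightRotation.mirror {S T : BinTree} (h : RightRotation S T) :
    RightRotation (mirror T) (mirror S) := by
  induction h with
  | root A B C => exact .root _ _ _
  | left R _ ih => exact .right _ ih
  | right L _ ih => exact .left _ ih

theorem TamariLE.mirror {S T : BinTree} (h : TamariLE S T) :
    TamariLE (mirror T) (mirror S) := by
  induction h with
  | refl => exact .refl _
  | tail _ h ih => exact h.mirror.tamariLE.trans ih

theorem tamariLE_mirror_iff {S T : BinTree} :
    TamariLE (mirror S) (mirror T) ↔ TamariLE T S :=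
  ⟨fun h => by simpa only [mirror_involutive _] using h.mirror, fun h => h.mirror⟩

theorem leftBranch_mirror (T : BinTree) : leftBranch (mirror T) = rightBranch T := by
  induction T with
  | nil => rfl
  | node _ L R _ ihR => simp [mirror, leftBranch, rightBranch, ihR]

theorem tamariPoly_mirror (T : BinTree) : tamariPoly (mirror T) = tamariPolyRev T := by
  induction T with
  | nil => rfl
  | node _ L R ihL ihR => simp [mirror, tamariPoly, tamariPolyRev, ihL, ihR]

theorem ncard_preimage_mirror (s : Set BinTree) : (mirror ⁻¹' s).ncard = s.ncard :=
  Set.ncard_preimage_of_injective_subset_range mirror_involutive.injective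
    (by simp [mirror_involutive.surjective.range_eq])

theorem setOf_ge_eq_preimage_mirror (T : BinTree) :
    {S | TamariLE T S} = mirror ⁻¹' {S | TamariLE S (mirror T)} := by
  ext S
  exact tamariLE_mirror_iff.symm

theorem setOf_ge_and_rightBranch_eq_preimage_mirror (T : BinTree) (k : ℕ) :
    {S | TamariLE T S ∧ rightBranch S = k} =
      mirror ⁻¹' {S | TamariLE S (mirror T) ∧ leftBranch S = k} := by
  ext S
  simp [tamariLE_mirror_iff, leftBranch_mirror]

end Tamari


/-- For every binary tree `T`: only finitely many trees are below (resp. above) `T` in the Tamari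
order; the coefficient of `x ^ k` in the Tamari polynomial of `T` is the number of trees below `T`
with `k` nodes on their left branch, and its value at `1` is the number of all trees below `T`;
symmetrically for the reversed polynomial, the trees above `T` and their right branches. -/
theorem mainTheorem2 (T : Tamari.BinTree) :
    ({T' | Tamari.TamariLE T' T}.Finite ∧
      (∀ k : ℕ, (Tamari.tamariPoly T).coeff k =
        ({T' | Tamari.TamariLE T' T ∧ Tamari.leftBranch T' = k}.ncard : ℤ)) ∧
      (Tamari.tamariPoly T).eval 1 = ({T' | Tamari.TamariLE T' T}.ncard : ℤ)) ∧
    ({T' | Tamari.TamariLE T T'}.Finite ∧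
      (∀ k : ℕ, (Tamari.tamariPolyRev T).coeff k =
        ({T' | Tamari.TamariLE T T' ∧ Tamari.rightBranch T' = k}.ncard : ℤ)) ∧
      (Tamari.tamariPolyRev T).eval 1 = ({T' | Tamari.TamariLE T T'}.ncard : ℤ)) := by
  refine ⟨⟨Tamari.finite_setOf_tamariLE T, Tamari.tamariPoly_coeff T,
    Tamari.tamariPoly_eval_one T⟩, ?_, fun k => ?_, ?_⟩
  · rw [Tamari.setOf_ge_eq_preimage_mirror]
    exact (Tamari.finite_setOf_tamariLE _).preimage Tamari.mirror_involutive.injective.injOn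
  · rw [Tamari.setOf_ge_and_rightBranch_eq_preimage_mirror, Tamari.ncard_preimage_mirror,
      ← Tamari.tamariPoly_mirror, Tamari.tamariPoly_coeff]
  · rw [Tamari.setOf_ge_eq_preimage_mirror, Tamari.ncard_preimage_mirror,
      ← Tamari.tamariPoly_mirror, Tamari.tamariPoly_eval_one]
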